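/- Let $\mathcal A$ be an exact homological category, i.e. a pointed, Barr exact (regular, with every internal equivalence relation a kernel pair) and Bourn protomodular category. A subobject is *proper* when it is represented by a kernel. A *Birkhoff subfunctor* of $\mathcal A$ is a subfunctor $\mu\colon V\Rightarrow 1_{\mathcal A}$ all of whose components $\mu_A\colon V(A)\to A$ are kernels, such that $V$ preserves regular epimorphisms. A *Birkhoff subcategory* is a full reflective subcategory closed under subobjects and under quotient objects (codomains of regular epimorphisms). Fix a Birkhoff subfunctor $\mu\colon V\Rightarrow 1_{\mathcal A}$. For a regular epimorphism $p\colon A_0\to A$ with kernel pair $k_0,k_1\colon R[p]\to A_0$, let $V_1p\to V(A_0)$ be the kernel of the coequalizer of $Vk_0,Vk_1\colon V(R[p])\to V(A_0)$; via $\mu_{A_0}$ it is regarded as a subobject of $A_0$. The extension $p$ is *$V$-central* when $V_1p=0$. A *$V$-central series* of an object $A$ is a descending sequence $A=A_0\supseteq A_1\supseteq A_2\supseteq\cdots$ of proper subobjects of $A$ such that $A/A_{i+1}\to A/A_i$ is $V$-central for all $i\in\mathbb N$. For $n\in\mathbb N$, $A$ is *$V$-nilpotent of class $n$* when it has a $V$-central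 series with $A_n=0$. The *$V$-lower central series* of $A$ is defined by $V_1^0(A)=A$ and $V_1^{n+1}(A)=V_1\bigl(A\to A/V_1^n(A)\bigr)$. Then for every $n\in\mathbb N$: 1. The subobjects $V_1^n(A)\subseteq A$ exist, are well defined up to isomorphism over $A$, and can be chosen to form a functor $V_1^n\colon\mathcal A\to\mathcal A$ with natural inclusion $V_1^n\Rightarrow 1_{\mathcal A}$. 2. An object $A$ is $V$-nilpotent of class $n$ if and only if $V_1^n(A)=0$. 3. $V_1^n$ is a Birkhoff subfunctor of $\mathcal A$. The corresponding Birkhoff subcategory is the full subcategory of all objects that are $V$-nilpotent of class $n$: this is a Birkhoff subcategory, its objects are exactly the quotients $A/V_1^n(A)$ (up to isomorphism), and for every $A$ there is a short exact sequence $0\to V_1^n(A)\to A\to A/V_1^n(A)\to 0$ in which $A\to A/V_1^n(A)$ is the reflection of $A$ into this subcategory. -/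

import Mathlib

open CategoryTheory CategoryTheory.Limits

universe v u

namespace RelNilp

section Categories

variable (C : Type u) [Category.{v} C]

/-- A category is (Barr) exact when it is regular and every internal equivalence relation in it
is a kernel pair. -/
class BarrExact : Prop extends Regular C where
  effective : ∀ {R X : C} (r₀ r₁ : R ⟶ X), IsEquivalenceRelation r₀ r₁ →
    ∃ (Y : C) (f : X ⟶ Y), IsKernelPair f r₀ r₁

/-- (Bourn) protomodularity: in a commutative diagram
```
X₁ --a--> X₂ --b--> X₃
|u        |v        |w
Y₁ --c--> Y₂ --d--> Y₃
```
in which `v` is a split epimorphism, if the left hand square and the outer rectangle are pullbacks,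
then so is the right hand square. -/
class Protomodular : Prop where
  isPullback_right : ∀ {X₁ X₂ X₃ Y₁ Y₂ Y₃ : C} (a : X₁ ⟶ X₂) (b : X₂ ⟶ X₃)
    (c : Y₁ ⟶ Y₂) (d : Y₂ ⟶ Y₃) (u : X₁ ⟶ Y₁) (v : X₂ ⟶ Y₂) (w : X₃ ⟶ Y₃),
    IsSplitEpi v → CommSq b v w d → IsPullback a u v c → IsPullback (a ≫ b) u w (c ≫ d) →
    IsPullback b v w d

/-- An exact homological category: pointed, Barr exact and protomodular. -/
class ExactHomological : Prop extends BarrExact C, Protomodular C, HasZeroObject C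

end Categories

variable {C : Type u} [Category.{v} C]

/-- `P`-reflection: `η : A ⟶ B` is a universal arrow from `A` to the full subcategory `P`. -/
def IsReflection (P : ObjectProperty C) {A B : C} (η : A ⟶ B) : Prop :=
  P B ∧ ∀ (X : C), P X → ∀ g : A ⟶ X, ∃! h : B ⟶ X, η ≫ h = g

/-- A Birkhoff subcategory: a full reflective subcategory, closed under subobjects and under
quotient objects (codomains of regular epimorphisms). -/
structure IsBirkhoffSubcategory (P : ObjectProperty C) : Prop where
  reflective : Nonempty (Reflective P.ι)
  of_mono : ∀ {X Y : C} (m : X ⟶ Y), Mono m → P Y → P X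
  of_regularEpi : ∀ {X Y : C} (e : X ⟶ Y), IsRegularEpi e → P X → P Y

variable [HasZeroMorphisms C]

/-- `k` is a kernel of `f`. -/
def IsKernelOf {K A B : C} (k : K ⟶ A) (f : A ⟶ B) : Prop :=
  ∃ w : k ≫ f = 0, Nonempty (IsLimit (KernelFork.ofι k w))

/-- `q` is a cokernel of `k`; when `k` is the inclusion of a proper subobject `K` of `A`, this
says that `q` is the quotient map `A ⟶ A / K`. -/
def IsCokernelOf {K A Q : C} (q : A ⟶ Q) (k : K ⟶ A) : Prop :=
  ∃ w : k ≫ q = 0, Nonempty (IsColimit (CokernelCofork.ofπ q w))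

/-- A monomorphism is proper when it is a kernel of some morphism. -/
def IsProper {K A : C} (k : K ⟶ A) : Prop :=
  ∃ (B : C) (f : A ⟶ B), IsKernelOf k f

/-- A Birkhoff subfunctor: a proper subfunctor `μ : V ⟶ 𝟭 C` of the identity functor such that `V`
preserves regular epimorphisms. -/
structure IsBirkhoffSubfunctor {V : C ⥤ C} (μ : V ⟶ 𝟭 C) : Prop where
  proper : ∀ A : C, IsProper (μ.app A)
  map_regularEpi : ∀ {A B : C} (p : A ⟶ B), IsRegularEpi p → IsRegularEpi (V.map p)

/-- `j : K ⟶ V(A₀)` represents the subobject `V₁ p` of `V(A₀)`, for `p : A₀ ⟶ A`: take a kernel pair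
`k₀, k₁ : R[p] ⟶ A₀` of `p`, then a coequalizer `c` of `V k₀, V k₁ : V(R[p]) ⟶ V(A₀)`, and finally
a kernel `j` of `c`. -/
def IsVOne (V : C ⥤ C) {A₀ A K : C} (p : A₀ ⟶ A) (j : K ⟶ V.obj A₀) : Prop :=
  ∃ (R Q : C) (k₀ k₁ : R ⟶ A₀) (c : V.obj A₀ ⟶ Q),
    IsKernelPair p k₀ k₁ ∧
    (∃ w : V.map k₀ ≫ c = V.map k₁ ≫ c, Nonempty (IsColimit (Cofork.ofπ c w))) ∧
    IsKernelOf j c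

/-- An extension (regular epimorphism) `f` is `V`-central when `V₁ f = 0`. -/
def IsVCentral (V : C ⥤ C) {X Y : C} (f : X ⟶ Y) : Prop :=
  IsRegularEpi f ∧ ∃ (K : C) (j : K ⟶ V.obj X), IsVOne V f j ∧ IsZero K

/-- A `V`-central series of `A`: a descending sequence `A = S 0 ⊇ S 1 ⊇ ⋯` of proper subobjects of
`A` such that each induced arrow `A / S (n + 1) ⟶ A / S n` is `V`-central. -/
structure IsCentralSeries (V : C ⥤ C) (A : C) (S : ℕ → Subobject A) : Prop where
  zero : S 0 = ⊤
  antitone : Antitone S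
  proper : ∀ n, IsProper (S n).arrow
  central : ∀ n, ∃ (Q' Q : C) (q' : A ⟶ Q') (q : A ⟶ Q) (f : Q' ⟶ Q),
    IsCokernelOf q' (S (n + 1)).arrow ∧ IsCokernelOf q (S n).arrow ∧ q' ≫ f = q ∧ IsVCentral V f

/-- `A` is `V`-nilpotent of class `n`: some `V`-central series of `A` is zero at stage `n`. -/
def IsNilpotentOfClass (V : C ⥤ C) (n : ℕ) : ObjectProperty C :=
  fun A => ∃ S : ℕ → Subobject A, IsCentralSeries V A S ∧ IsZero (S n : C)

/-- `i : K ⟶ A` represents the `n`-th term `V₁ⁿ(A)` of the `V`-lower central series of `A`, where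
`V₁⁰(A) = A` and `V₁ⁿ⁺¹(A) = V₁(A ⟶ A / V₁ⁿ(A))`, the latter being considered as a subobject of `A`
through `V₁(A ⟶ A / V₁ⁿ(A)) ⟶ V(A) ⟶ A`. -/
def IsLowerCentralTerm {V : C ⥤ C} (μ : V ⟶ 𝟭 C) : ℕ → ∀ {K A : C}, (K ⟶ A) → Prop
  | 0, _, _, i => IsIso i
  | n + 1, K, A, i => ∃ (N Q : C) (m : N ⟶ A) (η : A ⟶ Q) (j : K ⟶ V.obj A),
      IsLowerCentralTerm μ n m ∧ IsCokernelOf η m ∧ IsVOne V η j ∧ j ≫ μ.app A = i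

/-- The full subcategory `P` is the Birkhoff subcategory corresponding to the subfunctor
`ν : W ⟶ 𝟭 C`: its objects are the quotients `A / W(A)`, and for every `A` there is a short exact
sequence `0 ⟶ W(A) ⟶ A ⟶ A / W(A) ⟶ 0` whose second map is the reflection of `A` into `P`. -/
structure IsCorrespondingSubcategory {W : C ⥤ C} (ν : W ⟶ 𝟭 C) (P : ObjectProperty C) : Prop where
  birkhoff : IsBirkhoffSubcategory P
  mem_iff : ∀ B : C, P B ↔ ∃ (A : C) (η : A ⟶ B), IsCokernelOf η (ν.app A)
  exact_reflection : ∀ A : C, ∃ (B : C) (η : A ⟶ B),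
    IsKernelOf (ν.app A) η ∧ IsCokernelOf η (ν.app A) ∧ IsReflection P η

end RelNilp

/-! Protomodularity makes the kernel and the section of a split epimorphism jointly extremally epic
(`isIso_of_kernel_of_section`). Hence relations are difunctional, reflexive relations are kernel
pairs by exactness, and direct images of kernels along regular epimorphisms are kernels
(`IsProper.image`). It follows that `V₁ p` is the image of `Ker (V k₀)` under `V k₁`
(`exists_isVOne`); in `A₀` this is the direct image along `k₁` of the meet of `V(R[p])` and `Ker
k₀`, hence proper.

This description drives the induction: a regular epimorphism that is regular epic on `V₁ⁿ` is so on
the kernel pairs of the quotients by `V₁ⁿ`, then on their images under `V`, then on the kernels of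
`V k₀`, and so on `V₁ⁿ⁺¹`.

The lower central series is the smallest central series. Functoriality of `V₁` places it inside
every other one; it is itself central because `V₁` of `A / V₁ⁿ⁺¹(A) ⟶ A / V₁ⁿ(A)` is a regular image
of `V₁ⁿ⁺¹(A)`, which dies in `A / V₁ⁿ⁺¹(A)`. Finally, the objects killed by any Birkhoff subfunctor
`W` form a Birkhoff subcategory with reflections `A / W(A)`. -/

namespace RelNilp

/-! ### Generalized elements in a regular category -/

section Refinements

variable {C : Type u} [Category.{v} C]

/-- Membership in a subobject is a local property. -/
lemma exists_factor_of_refinement {M Y T T' : C} (m : M ⟶ Y) [Mono m] {y : T ⟶ Y} (π : T' ⟶ T)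
    [IsRegularEpi π] (x : T' ⟶ M) (h : x ≫ m = π ≫ y) : ∃ z : T ⟶ M, z ≫ m = y :=
  have sq : CommSq x π m y := ⟨h⟩
  ⟨sq.lift, sq.fac_right⟩

variable [Regular C]

lemma isRegularEpi_of_comp {X Y Z : C} (f : X ⟶ Y) (g : Y ⟶ Z) [IsRegularEpi (f ≫ g)] :
    IsRegularEpi g := by
  have : StrongEpi g := strongEpi_of_strongEpi f g
  infer_instance

lemma isRegularEpi_comp {X Y Z : C} (f : X ⟶ Y) (g : Y ⟶ Z) [IsRegularEpi f] [IsRegularEpi g] :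
    IsRegularEpi (f ≫ g) := by
  have : StrongEpi (f ≫ g) := strongEpi_comp f g
  infer_instance

/-- Every generalized element of the codomain of a regular epimorphism lifts, after a refinement. -/
lemma exists_refinement {X Y T : C} (e : X ⟶ Y) [IsRegularEpi e] (y : T ⟶ Y) :
    ∃ (T' : C) (π : T' ⟶ T) (x : T' ⟶ X), IsRegularEpi π ∧ x ≫ e = π ≫ y :=
  ⟨_, pullback.snd e y, pullback.fst e y, inferInstance, pullback.condition⟩

lemma isRegularEpi_of_refinement {X Y : C} (f : X ⟶ Y)
    (h : ∀ {T : C} (y : T ⟶ Y), ∃ (T' : C) (π : T' ⟶ T) (x : T' ⟶ X),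
      IsRegularEpi π ∧ x ≫ f = π ≫ y) : IsRegularEpi f := by
  obtain ⟨T', π, x, hπ, hx⟩ := h (𝟙 Y)
  rw [Category.comp_id] at hx
  have : IsRegularEpi (x ≫ f) := hx ▸ hπ
  exact isRegularEpi_of_comp x f

lemma exists_image_factorisation {X Y : C} (f : X ⟶ Y) :
    ∃ (I : C) (e : X ⟶ I) (m : I ⟶ Y), IsRegularEpi e ∧ Mono m ∧ e ≫ m = f :=
  ⟨_, (Regular.strongEpiMonoFactorisation f).e, (Regular.strongEpiMonoFactorisation f).m,
    inferInstance, inferInstance, (Regular.strongEpiMonoFactorisation f).fac⟩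

/-- Comes from the image of the span in the product; it turns a span into a relation, to which
difunctionality applies. -/
lemma exists_image_relation {R X Y : C} (a : R ⟶ X) (b : R ⟶ Y) :
    ∃ (D : C) (e : R ⟶ D) (d₀ : D ⟶ X) (d₁ : D ⟶ Y), IsRegularEpi e ∧ JointlyMono₂ d₀ d₁ ∧
      e ≫ d₀ = a ∧ e ≫ d₁ = b := by
  obtain ⟨D, e, m, he, hm, hem⟩ := exists_image_factorisation (prod.lift a b)
  refine ⟨D, e, m ≫ prod.fst, m ≫ prod.snd, he, ⟨fun Y f g h₀ h₁ => ?_⟩, ?_, ?_⟩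
  · rw [← cancel_mono m]
    ext <;> simpa
  · rw [reassoc_of% hem, prod.lift_fst]
  · rw [reassoc_of% hem, prod.lift_snd]

end Refinements

/-! ### Kernels, cokernels and proper subobjects -/

section Kernels

variable {C : Type u} [Category.{v} C] [HasZeroMorphisms C]

lemma IsKernelOf.mono {K A B : C} {k : K ⟶ A} {f : A ⟶ B} (h : IsKernelOf k f) : Mono k := by
  obtain ⟨w, ⟨hk⟩⟩ := h
  exact ⟨fun a b hab => Fork.IsLimit.hom_ext hk (by simpa using hab)⟩

lemma IsKernelOf.exists_lift {K A B T : C} {k : K ⟶ A} {f : A ⟶ B} (h : IsKernelOf k f)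
    (x : T ⟶ A) (hx : x ≫ f = 0) : ∃ z : T ⟶ K, z ≫ k = x := by
  obtain ⟨w, ⟨hk⟩⟩ := h
  obtain ⟨l, hl⟩ := KernelFork.IsLimit.lift' hk x hx
  exact ⟨l, by simpa using hl⟩

lemma isKernelOf_of_exists_lift {K A B : C} {k : K ⟶ A} {f : A ⟶ B} [Mono k] (w : k ≫ f = 0)
    (h : ∀ {T : C} (x : T ⟶ A), x ≫ f = 0 → ∃ z : T ⟶ K, z ≫ k = x) : IsKernelOf k f := by
  choose l hl using @h
  exact ⟨w, ⟨KernelFork.IsLimit.ofι' k w fun x hx => ⟨l x hx, hl x hx⟩⟩⟩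

lemma IsProper.mono {K A : C} {k : K ⟶ A} (h : IsProper k) : Mono k := by
  obtain ⟨B, f, hf⟩ := h
  exact hf.mono

lemma IsCokernelOf.epi {K A Q : C} {q : A ⟶ Q} {k : K ⟶ A} (h : IsCokernelOf q k) : Epi q := by
  obtain ⟨w, ⟨hq⟩⟩ := h
  exact ⟨fun a b hab => Cofork.IsColimit.hom_ext hq (by simpa using hab)⟩

lemma IsCokernelOf.exists_desc {K A Q T : C} {q : A ⟶ Q} {k : K ⟶ A} (h : IsCokernelOf q k)
    (x : A ⟶ T) (hx : k ≫ x = 0) : ∃ z : Q ⟶ T, q ≫ z = x := by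
  obtain ⟨w, ⟨hq⟩⟩ := h
  obtain ⟨l, hl⟩ := CokernelCofork.IsColimit.desc' hq x hx
  exact ⟨l, by simpa using hl⟩

lemma IsCokernelOf.isRegularEpi {K A Q : C} {q : A ⟶ Q} {k : K ⟶ A} (h : IsCokernelOf q k) :
    IsRegularEpi q := by
  obtain ⟨w, ⟨hq⟩⟩ := h
  exact ⟨⟨Cofork.IsColimit.regularEpi hq⟩⟩

lemma isCokernelOf_of_exists_desc {K A Q : C} {q : A ⟶ Q} {k : K ⟶ A} [Epi q] (w : k ≫ q = 0)
    (h : ∀ {T : C} (x : A ⟶ T), k ≫ x = 0 → ∃ z : Q ⟶ T, q ≫ z = x) : IsCokernelOf q k := by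
  choose l hl using @h
  exact ⟨w, ⟨CokernelCofork.IsColimit.ofπ' q w fun x hx => ⟨l x hx, hl x hx⟩⟩⟩

/-- A proper subobject is the kernel of its cokernel. -/
lemma IsProper.isKernelOf {K A Q : C} {k : K ⟶ A} {q : A ⟶ Q} (hk : IsProper k)
    (hq : IsCokernelOf q k) : IsKernelOf k q := by
  have := hk.mono
  obtain ⟨B, f, hf⟩ := hk
  obtain ⟨z, hz⟩ := hq.exists_desc f hf.1
  exact isKernelOf_of_exists_lift hq.1 fun x hx =>
    hf.exists_lift x (by rw [← hz, reassoc_of% hx, zero_comp])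

lemma isZero_of_mono_eq_zero {X Y : C} (m : X ⟶ Y) [Mono m] (h : m = 0) : IsZero X := by
  rw [IsZero.iff_id_eq_zero, ← cancel_mono m, h, comp_zero, comp_zero]

lemma isZero_of_epi_eq_zero {X Y : C} (e : X ⟶ Y) [Epi e] (h : e = 0) : IsZero Y := by
  rw [IsZero.iff_id_eq_zero, ← cancel_epi e, h, zero_comp, zero_comp]

end Kernels

/-! ### Consequences of protomodularity and exactness -/

section ExactHomological

attribute [local simp] prod.lift_fst prod.lift_snd prod.lift_fst_assoc prod.lift_snd_assoc
  pullback.lift_fst pullback.lift_snd pullback.lift_fst_assoc pullback.lift_snd_assoc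

variable {C : Type u} [Category.{v} C] [HasZeroMorphisms C] [ExactHomological C]

/-- The kernel and a section of a split epimorphism are jointly extremally epimorphic. -/
lemma isIso_of_kernel_of_section {M R X : C} (r : R ⟶ X) (m : M ⟶ R) [Mono m] (s : X ⟶ M)
    (hs : (s ≫ m) ≫ r = 𝟙 X) (k : kernel r ⟶ M) (hk : k ≫ m = kernel.ι r) : IsIso m := by
  open ZeroObject in
  have hv : IsSplitEpi (m ≫ r) := ⟨⟨⟨s, by simpa using hs⟩⟩⟩
  have hl : IsPullback k (0 : kernel r ⟶ 0) (m ≫ r) (0 : 0 ⟶ X) :=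
    IsPullback.of_isLimit' ⟨by rw [reassoc_of% hk]; simp⟩ <| PullbackCone.IsLimit.mk _
      (fun t => kernel.lift r (t.fst ≫ m) (by simpa using t.condition))
      (fun t => by rw [← cancel_mono m, Category.assoc, hk, kernel.lift_ι])
      (fun t => (isZero_zero C).eq_of_tgt _ _)
      (fun t l hl _ => by rw [← cancel_mono (kernel.ι r), kernel.lift_ι, ← hl, Category.assoc, hk])
  have ho : IsPullback (k ≫ m) (0 : kernel r ⟶ 0) r ((0 : 0 ⟶ X) ≫ 𝟙 X) := by
    rw [hk, Category.comp_id]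
    exact IsPullback.of_isLimit' ⟨by simp⟩ <| PullbackCone.IsLimit.mk _
      (fun t => kernel.lift r t.fst (by simpa using t.condition))
      (fun t => kernel.lift_ι _ _ _)
      (fun t => (isZero_zero C).eq_of_tgt _ _)
      (fun t l hl _ => by rw [← cancel_mono (kernel.ι r), kernel.lift_ι, ← hl])
  -- Both kernels are pullbacks along `0 ⟶ X`, so the square with sides `m` and `𝟙 X` is a pullback.
  exact (Protomodular.isPullback_right k m 0 (𝟙 X) 0 (m ≫ r) r hv ⟨by simp⟩ hl ho).isIso_fst_of_isIso

/-- Two arrows out of the domain of a split epimorphism agree when they agree on the kernel and on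
a section. -/
lemma hom_ext_of_kernel_of_section {R X Z : C} (r : R ⟶ X) (s : X ⟶ R) (hs : s ≫ r = 𝟙 X)
    {a b : R ⟶ Z} (hk : kernel.ι r ≫ a = kernel.ι r ≫ b) (h : s ≫ a = s ≫ b) : a = b := by
  have := isIso_of_kernel_of_section r (equalizer.ι a b) (equalizer.lift s h) (by simpa using hs)
    (equalizer.lift _ hk) (by simp)
  rw [← cancel_epi (equalizer.ι a b), equalizer.condition]

/-- Every relation is difunctional. -/
lemma exists_difunctional {D X Y T : C} (d₀ : D ⟶ X) (d₁ : D ⟶ Y) [JointlyMono₂ d₀ d₁]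
    (a b c : T ⟶ D) (hab : a ≫ d₁ = b ≫ d₁) (hbc : b ≫ d₀ = c ≫ d₀) :
    ∃ d : T ⟶ D, d ≫ d₀ = a ≫ d₀ ∧ d ≫ d₁ = c ≫ d₁ := by
  let u : pullback d₁ d₁ ⟶ D := pullback.snd d₁ d₁
  let w : pullback d₀ d₀ ⟶ D := pullback.fst d₀ d₀
  -- `pullback u w` consists of the zigzags `(a, b, c)`, and `φ` sends one to the pair that must lie
  -- in `D`. It projects to `(b, c)`, with section `a = b`. On the section the pair is `c` itself;
  -- on the kernel `b = c = 0` and it is `a`. So `φ` factors through `D`.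
  let φ : pullback u w ⟶ X ⨯ Y :=
    prod.lift (pullback.fst u w ≫ pullback.fst d₁ d₁ ≫ d₀) (pullback.snd u w ≫ pullback.snd d₀ d₀ ≫ d₁)
  have : Mono (prod.lift d₀ d₁) := ⟨fun f g h => JointlyMono₂.right_cancellation (p₁ := d₀) (p₂ := d₁)
    f g (by simpa using h =≫ prod.fst) (by simpa using h =≫ prod.snd)⟩
  let s : pullback d₀ d₀ ⟶ pullback u w :=
    pullback.lift (w ≫ pullback.lift (𝟙 D) (𝟙 D) rfl) (𝟙 _) (by simp [u])
  have hs : pullback.snd d₀ d₀ ≫ prod.lift d₀ d₁ = s ≫ φ := by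
    ext
    · simp [s, φ, w, pullback.condition]
    · simp [s, φ]
  have hk : (kernel.ι (pullback.snd u w) ≫ pullback.fst u w ≫ pullback.fst d₁ d₁) ≫
      prod.lift d₀ d₁ = kernel.ι (pullback.snd u w) ≫ φ := by
    ext
    · simp [φ]
    · have := pullback.condition (f := u) (g := w)
      have h : kernel.ι (pullback.snd u w) ≫ pullback.fst u w ≫ u = 0 := by
        rw [this, kernel.condition_assoc, zero_comp]
      simp only [Category.assoc, φ, prod.lift_snd, kernel.condition_assoc, zero_comp]
      rw [pullback.condition, reassoc_of% h, zero_comp]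
  have := isIso_of_kernel_of_section (pullback.snd u w) (pullback.snd (prod.lift d₀ d₁) φ)
    (pullback.lift _ _ hs) (by simp [s]) (pullback.lift _ _ hk) (by simp)
  let t : T ⟶ pullback u w := pullback.lift (pullback.lift a b hab) (pullback.lift b c hbc)
    (by simp [u, w])
  have ht : (t ≫ inv (pullback.snd (prod.lift d₀ d₁) φ) ≫ pullback.fst _ _) ≫ prod.lift d₀ d₁ =
      t ≫ φ := by
    rw [Category.assoc, Category.assoc, pullback.condition, IsIso.inv_hom_id_assoc]
  refine ⟨t ≫ inv (pullback.snd (prod.lift d₀ d₁) φ) ≫ pullback.fst _ _, ?_, ?_⟩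
  · simpa [φ, t] using ht =≫ prod.fst
  · simpa [φ, t] using ht =≫ prod.snd

/-- A reflexive relation is an equivalence relation. -/
lemma isEquivalenceRelation_of_reflexive {D X : C} (d₀ d₁ : D ⟶ X) [hD : JointlyMono₂ d₀ d₁]
    (r : X ⟶ D) (h₀ : r ≫ d₀ = 𝟙 X) (h₁ : r ≫ d₁ = 𝟙 X) : IsEquivalenceRelation d₀ d₁ := by
  -- Symmetry uses the zigzag `(y, y), (x, y), (x, x)`; transitivity uses `(x, y), (y, y), (y, z)`.
  obtain ⟨s, hs₀, hs₁⟩ := exists_difunctional d₀ d₁ (d₁ ≫ r) (𝟙 D) (d₀ ≫ r) (by simp [h₁])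
    (by simp [h₀])
  obtain ⟨t, ht₀, ht₁⟩ := exists_difunctional d₀ d₁ (pullback.fst d₁ d₀)
    (pullback.fst d₁ d₀ ≫ d₁ ≫ r) (pullback.snd d₁ d₀) (by simp [h₁])
    (by simp [h₀, pullback.condition])
  exact ⟨⟨{
    right_cancellation := hD.right_cancellation
    r := r
    reflexivity₁ := h₀
    reflexivity₂ := h₁
    s := s
    symmetry₁ := by simpa [h₀] using hs₀
    symmetry₂ := by simpa [h₁] using hs₁
    c := _
    isLimit := pullbackIsPullback d₁ d₀
    t := t
    transitivity₁ := ht₀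
    transitivity₂ := ht₁ }⟩⟩

/-- A regular epimorphism between split epimorphisms is regular epic on kernels. -/
lemma exists_refinement_kernel {R S X Y T : C} (F : R ⟶ S) [IsRegularEpi F] {f : X ⟶ Y}
    {r : R ⟶ X} {δ : X ⟶ R} (hδ : δ ≫ r = 𝟙 X) {s : S ⟶ Y} {ε : Y ⟶ S}
    (h : F ≫ s = r ≫ f) (h' : δ ≫ F = f ≫ ε) (l : T ⟶ S) (hl : l ≫ s = 0) :
    ∃ (T' : C) (π : T' ⟶ T) (l' : T' ⟶ R), IsRegularEpi π ∧ l' ≫ r = 0 ∧ l' ≫ F = π ≫ l := by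
  obtain ⟨D, e, d₀, d₁, he, hD, hd₀, hd₁⟩ := exists_image_relation F r
  obtain ⟨T₁, π₁, ρ, hπ₁, hρ⟩ := exists_refinement F l
  have hx : ρ ≫ r ≫ f = 0 := by rw [← h, reassoc_of% hρ, hl, comp_zero]
  -- In the image `D` of `(F, r)`, the zigzag `(F ρ, r ρ), (0, r ρ), (0, 0)` produces `(F ρ, 0)`.
  -- The middle pair is the image of `ρ ≫ r ≫ δ`.
  obtain ⟨d, hdd₀, hdd₁⟩ := exists_difunctional d₀ d₁ (ρ ≫ e) (ρ ≫ r ≫ δ ≫ e) 0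
    (by simp [hd₁, hδ]) (by simp [hd₀, h', reassoc_of% hx])
  obtain ⟨T₂, π₂, l', hπ₂, hl'⟩ := exists_refinement e d
  refine ⟨T₂, π₂ ≫ π₁, l', isRegularEpi_comp _ _, ?_, ?_⟩
  · rw [← hd₁, reassoc_of% hl', hdd₁, zero_comp, comp_zero]
  · rw [← hd₀, reassoc_of% hl', hdd₀, Category.assoc, hd₀, hρ, Category.assoc]

/-- The regular image of a proper subobject is proper. -/
lemma IsProper.image {K X Y L : C} {k : K ⟶ X} (hk : IsProper k) (f : X ⟶ Y) [IsRegularEpi f]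
    (e : K ⟶ L) [IsRegularEpi e] (m : L ⟶ Y) [Mono m] (h : e ≫ m = k ≫ f) : IsProper m := by
  obtain ⟨Z, g, hg⟩ := hk
  -- `D` is the direct image of the kernel pair of `g`. It is reflexive, hence the kernel pair of
  -- some `p`; the zero class of `D` lifts locally to that of `g`, which is `K`. So `L` is the
  -- kernel of `p`.
  obtain ⟨D, q, d₀, d₁, hq, hD, hd₀, hd₁⟩ :=
    exists_image_relation (pullback.fst g g ≫ f) (pullback.snd g g ≫ f)
  let δ : X ⟶ pullback g g := pullback.lift (𝟙 X) (𝟙 X) rfl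
  have : Mono (prod.lift d₀ d₁) := ⟨fun f g h => hD.right_cancellation
    f g (by simpa using h =≫ prod.fst) (by simpa using h =≫ prod.snd)⟩
  obtain ⟨ε, hε⟩ := exists_factor_of_refinement (prod.lift d₀ d₁) (y := prod.lift (𝟙 Y) (𝟙 Y)) f
    (δ ≫ q) (by ext <;> simp [hd₀, hd₁, δ])
  have hε₀ : ε ≫ d₀ = 𝟙 Y := by simpa using hε =≫ prod.fst
  have hε₁ : ε ≫ d₁ = 𝟙 Y := by simpa using hε =≫ prod.snd
  obtain ⟨W, p, hp⟩ := BarrExact.effective d₀ d₁ (isEquivalenceRelation_of_reflexive d₀ d₁ ε hε₀ hε₁)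
  refine ⟨W, p, isKernelOf_of_exists_lift ?_ fun {T} y hy => ?_⟩
  · let z : K ⟶ pullback g g := pullback.lift 0 k (by rw [hg.1, zero_comp])
    have h₀ : (z ≫ q) ≫ d₀ = 0 := by simp [hd₀, z]
    have h₁ : (z ≫ q) ≫ d₁ = k ≫ f := by simp [hd₁, z]
    rw [← cancel_epi e, reassoc_of% h, ← Category.assoc, ← h₁, Category.assoc, ← hp.w,
      ← Category.assoc, h₀, zero_comp, comp_zero]
  · obtain ⟨T', π, l, hπ, hl, hl'⟩ := exists_refinement_kernel q (r := pullback.fst g g) (δ := δ)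
      (by simp [δ]) (s := d₀) (ε := ε) (f := f) hd₀
      (hD.right_cancellation _ _ (by simp [hd₀, hε₀, δ]) (by simp [hd₁, hε₁, δ]))
      (hp.lift 0 y (by rw [hy, zero_comp])) (by simp)
    obtain ⟨x, hx⟩ := hg.exists_lift (l ≫ pullback.snd g g)
      (by rw [Category.assoc, ← pullback.condition, reassoc_of% hl, zero_comp])
    refine exists_factor_of_refinement m π (x ≫ e) ?_
    rw [Category.assoc, h, reassoc_of% hx, ← hd₁, reassoc_of% hl', IsKernelPair.lift_snd]

/-- A regular epimorphism is the cokernel of its kernel. -/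
lemma IsKernelOf.isCokernelOf {K A Q : C} {k : K ⟶ A} {q : A ⟶ Q} [IsRegularEpi q]
    (h : IsKernelOf k q) : IsCokernelOf q k := by
  refine isCokernelOf_of_exists_desc h.1 fun x hx =>
    IsRegularEpi.exists_of_isKernelPair q (IsKernelPair.of_hasPullback q) x ?_
  -- Both composites with `x` agree on the diagonal, and vanish on the kernel of the first
  -- projection, whose second projection lands in `K`.
  refine hom_ext_of_kernel_of_section (pullback.fst q q) (pullback.lift (𝟙 A) (𝟙 A) rfl) (by simp)
    ?_ (by simp)
  obtain ⟨z, hz⟩ := h.exists_lift (kernel.ι (pullback.fst q q) ≫ pullback.snd q q)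
    (by rw [Category.assoc, ← pullback.condition, kernel.condition_assoc, zero_comp])
  rw [kernel.condition_assoc, zero_comp, ← Category.assoc, ← hz, Category.assoc, hx, comp_zero]

lemma IsProper.exists_isCokernelOf {K A : C} {k : K ⟶ A} (hk : IsProper k) :
    ∃ (Q : C) (q : A ⟶ Q), IsCokernelOf q k := by
  have := hk.mono
  obtain ⟨B, f, hf⟩ := hk
  obtain ⟨Q, q, m, hq, hm, rfl⟩ := exists_image_factorisation f
  have w : k ≫ q = 0 := by rw [← cancel_mono m, Category.assoc, hf.1, zero_comp]
  have : IsKernelOf k q := isKernelOf_of_exists_lift w fun x hx =>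
    hf.exists_lift x (by rw [reassoc_of% hx, zero_comp])
  exact ⟨Q, q, this.isCokernelOf⟩

/-- A morphism of kernel pairs is a regular epimorphism when it is so on objects and on kernels. -/
lemma isRegularEpi_kernelPair_map {K L A B Q Q' R S : C} {k : K ⟶ A} {l : L ⟶ B} {p : A ⟶ Q}
    {q : B ⟶ Q'} (hk : IsKernelOf k p) (hl : IsKernelOf l q) {p₀ p₁ : R ⟶ A} {q₀ q₁ : S ⟶ B}
    (hp : IsKernelPair p p₀ p₁) (hq : IsKernelPair q q₀ q₁) (f : A ⟶ B) [IsRegularEpi f]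
    (t : K ⟶ L) [IsRegularEpi t] (ht : t ≫ l = k ≫ f) (F : R ⟶ S) (h₀ : F ≫ q₀ = p₀ ≫ f)
    (h₁ : F ≫ q₁ = p₁ ≫ f) : IsRegularEpi F := by
  -- The image of `F` contains the diagonal because `f` is regular epic, and the kernel of `q₀`
  -- because `t` is; so it is everything.
  obtain ⟨I, e, m, he, hm, rfl⟩ := exists_image_factorisation F
  let δ : A ⟶ R := hp.lift (𝟙 A) (𝟙 A) rfl
  let ε : B ⟶ S := hq.lift (𝟙 B) (𝟙 B) rfl
  have hδ : δ ≫ e ≫ m = f ≫ ε := hq.hom_ext (by simp [h₀, δ, ε]) (by simp [h₁, δ, ε])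
  obtain ⟨s, hs⟩ := exists_factor_of_refinement m f (δ ≫ e) (y := ε) (by simpa using hδ)
  obtain ⟨y, hy⟩ := hl.exists_lift (kernel.ι q₀ ≫ q₁)
    (by rw [Category.assoc, ← hq.w, kernel.condition_assoc, zero_comp])
  obtain ⟨T, π, x, hπ, hx⟩ := exists_refinement t y
  let z : T ⟶ R := hp.lift 0 (x ≫ k) (by rw [Category.assoc, hk.1, zero_comp, comp_zero])
  have hz : (z ≫ e) ≫ m = π ≫ kernel.ι q₀ := by
    refine hq.hom_ext ?_ ?_
    · simp only [Category.assoc] at h₀ ⊢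
      simp [h₀, z]
    · simp only [Category.assoc] at h₁ ⊢
      rw [h₁, ← hy, ← reassoc_of% hx, ht]
      simp [z]
  obtain ⟨w, hw⟩ := exists_factor_of_refinement m π (z ≫ e) hz
  have := isIso_of_kernel_of_section q₀ m s (by simp [hs, ε]) w hw
  exact isRegularEpi_comp e m

end ExactHomological

/-! ### The subobject `V₁ p` -/

section VOne

variable {C : Type u} [Category.{v} C] [HasZeroMorphisms C]

lemma IsProper.of_iso {K K' A : C} {k : K ⟶ A} {k' : K' ⟶ A} (h : IsProper k) (e : K ≅ K')
    (he : e.hom ≫ k' = k) : IsProper k' := by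
  have := h.mono
  have hk' : k' = e.inv ≫ k := by rw [← he, e.inv_hom_id_assoc]
  obtain ⟨B, f, hf⟩ := h
  have : Mono k' := hk' ▸ mono_comp e.inv k
  refine ⟨B, f, isKernelOf_of_exists_lift (by rw [hk', Category.assoc, hf.1, comp_zero]) ?_⟩
  intro T x hx
  obtain ⟨z, hz⟩ := hf.exists_lift x hx
  exact ⟨z ≫ e.hom, by rw [Category.assoc, he, hz]⟩

lemma IsCokernelOf.of_iso {K K' A Q : C} {q : A ⟶ Q} {k : K ⟶ A} {k' : K' ⟶ A}
    (h : IsCokernelOf q k) (e : K ≅ K') (he : e.hom ≫ k' = k) : IsCokernelOf q k' := by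
  have := h.epi
  refine isCokernelOf_of_exists_desc ?_ fun x hx =>
    h.exists_desc x (by rw [← he, Category.assoc, hx, comp_zero])
  rw [← cancel_epi e.hom, reassoc_of% he, h.1, comp_zero]

variable {V : C ⥤ C}

lemma IsVOne.mono {A₀ A K : C} {p : A₀ ⟶ A} {j : K ⟶ V.obj A₀} (h : IsVOne V p j) : Mono j := by
  obtain ⟨R, Q, k₀, k₁, c, hk, hc, hj⟩ := h
  exact hj.mono

/-- `V₁` is functorial. -/
lemma IsVOne.exists_map {A₀ A B₀ B K L : C} {p : A₀ ⟶ A} {q : B₀ ⟶ B} {j : K ⟶ V.obj A₀}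
    {l : L ⟶ V.obj B₀} (hj : IsVOne V p j) (hl : IsVOne V q l) (f : A₀ ⟶ B₀) (g : A ⟶ B)
    (w : p ≫ g = f ≫ q) : ∃ t : K ⟶ L, t ≫ l = j ≫ V.map f := by
  obtain ⟨R, Q, k₀, k₁, c, hk, ⟨wc, ⟨hc⟩⟩, hj⟩ := hj
  obtain ⟨S, Q', l₀, l₁, c', hl', ⟨wc', -⟩, hl⟩ := hl
  have hw : (k₀ ≫ f) ≫ q = (k₁ ≫ f) ≫ q := by
    rw [Category.assoc, Category.assoc, ← w, hk.w_assoc]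
  obtain ⟨d, hd⟩ := Cofork.IsColimit.desc' hc (V.map f ≫ c') (by
    have h₀ := congrArg V.map (hl'.lift_fst _ _ hw)
    have h₁ := congrArg V.map (hl'.lift_snd _ _ hw)
    simp only [V.map_comp] at h₀ h₁
    rw [← reassoc_of% h₀, ← reassoc_of% h₁, wc'])
  refine hl.exists_lift _ ?_
  rw [Category.assoc, ← hd, Cofork.π_ofπ, reassoc_of% hj.1, zero_comp]

lemma IsVOne.exists_iso {A₀ A K L : C} {p : A₀ ⟶ A} {j : K ⟶ V.obj A₀} {l : L ⟶ V.obj A₀}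
    (hj : IsVOne V p j) (hl : IsVOne V p l) : ∃ e : K ≅ L, e.hom ≫ l = j := by
  have := hj.mono
  have := hl.mono
  obtain ⟨s, hs⟩ := hj.exists_map hl (𝟙 _) (𝟙 _) (by simp)
  obtain ⟨t, ht⟩ := hl.exists_map hj (𝟙 _) (𝟙 _) (by simp)
  rw [V.map_id, Category.comp_id] at hs ht
  exact ⟨⟨s, t, by rw [← cancel_mono j, Category.assoc, ht, hs, Category.id_comp],
    by rw [← cancel_mono l, Category.assoc, hs, ht, Category.id_comp]⟩, hs⟩

lemma IsVOne.comp_eq_zero {μ : V ⟶ 𝟭 C} {A₀ A K : C} {p : A₀ ⟶ A} {j : K ⟶ V.obj A₀}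
    (hj : IsVOne V p j) : (j ≫ μ.app A₀) ≫ p = 0 := by
  obtain ⟨R, Q, k₀, k₁, c, hk, ⟨wc, ⟨hc⟩⟩, hj⟩ := hj
  obtain ⟨d, hd⟩ := Cofork.IsColimit.desc' hc (μ.app A₀ ≫ p) (by
    rw [μ.naturality_assoc, μ.naturality_assoc, Functor.id_map, Functor.id_map, hk.w])
  rw [Category.assoc, ← hd, Cofork.π_ofπ, reassoc_of% hj.1, zero_comp]

/-- With `IsVOne.exists_refinement`, this gives the elementwise description of `V₁ p`: locally, its
elements are the second components of elements of `V(R[p])` with first component zero. -/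
lemma IsVOne.exists_lift {A₀ A K R T : C} {p : A₀ ⟶ A} {j : K ⟶ V.obj A₀} (hj : IsVOne V p j)
    {k₀ k₁ : R ⟶ A₀} (w : k₀ ≫ p = k₁ ≫ p) (l : T ⟶ V.obj R) (hl : l ≫ V.map k₀ = 0) :
    ∃ x : T ⟶ K, x ≫ j = l ≫ V.map k₁ := by
  obtain ⟨S, Q, l₀, l₁, c, hS, ⟨wc, -⟩, hj⟩ := hj
  refine hj.exists_lift _ ?_
  rw [← hS.lift_fst k₀ k₁ w, V.map_comp] at hl
  rw [← hS.lift_snd k₀ k₁ w, V.map_comp, Category.assoc, Category.assoc, ← wc, reassoc_of% hl,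
    zero_comp]

variable [ExactHomological C]

/-- `V₁ p` exists, and it is the image of the kernel of `V k₀` under `V k₁`. -/
lemma exists_isVOne {μ : V ⟶ 𝟭 C} (hμ : IsBirkhoffSubfunctor μ) {A₀ A R : C} {p : A₀ ⟶ A}
    {k₀ k₁ : R ⟶ A₀} (hk : IsKernelPair p k₀ k₁) :
    ∃ (K : C) (j : K ⟶ V.obj A₀) (e : kernel (V.map k₀) ⟶ K), IsVOne V p j ∧
      IsProper (j ≫ μ.app A₀) ∧ IsRegularEpi e ∧ e ≫ j = kernel.ι (V.map k₀) ≫ V.map k₁ := by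
  obtain ⟨K, e, j, he, hj, hej⟩ := exists_image_factorisation (kernel.ι (V.map k₀) ≫ V.map k₁)
  have hA := (hμ.proper A₀).mono
  have hR := (hμ.proper R).mono
  have hL : IsProper (kernel.ι (V.map k₀) ≫ μ.app R) := by
    obtain ⟨Z, g, hg⟩ := hμ.proper R
    -- The kernel of `V k₀`, seen in `R`, is the meet of `V(R)`, the kernel of `g`, with the kernel
    -- of `k₀`.
    refine ⟨Z ⨯ A₀, prod.lift g k₀, isKernelOf_of_exists_lift ?_ fun x hx => ?_⟩
    · ext
      · rw [Category.assoc, Category.assoc, prod.lift_fst, hg.1, comp_zero, zero_comp]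
      · have := μ.naturality k₀
        rw [Functor.id_map] at this
        rw [Category.assoc, Category.assoc, prod.lift_snd, ← this, kernel.condition_assoc, zero_comp,
          zero_comp]
    · have hx₀ : x ≫ g = 0 := by simpa [prod.lift_fst] using hx =≫ prod.fst
      have hx₁ : x ≫ k₀ = 0 := by simpa [prod.lift_snd] using hx =≫ prod.snd
      obtain ⟨y, hy⟩ := hg.exists_lift x hx₀
      refine ⟨kernel.lift _ y ?_, by rw [kernel.lift_ι_assoc, hy]⟩
      have := μ.naturality k₀
      rw [Functor.id_map] at this
      rw [← cancel_mono (μ.app A₀), Category.assoc, this, reassoc_of% hy, hx₁, zero_comp]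
  let δ : A₀ ⟶ R := hk.lift (𝟙 A₀) (𝟙 A₀) rfl
  have hδ₀ : δ ≫ k₀ = 𝟙 A₀ := by simp [δ]
  have hδ₁ : δ ≫ k₁ = 𝟙 A₀ := by simp [δ]
  have : IsSplitEpi k₁ := ⟨⟨⟨δ, hδ₁⟩⟩⟩
  have hjμ : IsProper (j ≫ μ.app A₀) := hL.image k₁ e (j ≫ μ.app A₀) (by
    have := μ.naturality k₁
    rw [Functor.id_map] at this
    rw [reassoc_of% hej, Category.assoc, this])
  have hj' : IsProper j := by
    obtain ⟨Z, g, hg⟩ := hjμ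
    refine ⟨Z, μ.app A₀ ≫ g, isKernelOf_of_exists_lift (by simpa using hg.1) fun x hx => ?_⟩
    obtain ⟨z, hz⟩ := hg.exists_lift (x ≫ μ.app A₀) (by simpa using hx)
    exact ⟨z, by rw [← cancel_mono (μ.app A₀), Category.assoc, hz]⟩
  obtain ⟨Q, c, hc⟩ := hj'.exists_isCokernelOf
  have hVδ₀ : V.map δ ≫ V.map k₀ = 𝟙 _ := by rw [← V.map_comp, hδ₀, V.map_id]
  have hVδ₁ : V.map δ ≫ V.map k₁ = 𝟙 _ := by rw [← V.map_comp, hδ₁, V.map_id]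
  -- The cokernel `c` of `j` is the required coequalizer: the two composites agree on the kernel of
  -- `V k₀` and on the section `V δ`.
  have wc : V.map k₀ ≫ c = V.map k₁ ≫ c := by
    refine hom_ext_of_kernel_of_section (V.map k₀) (V.map δ) hVδ₀ ?_ ?_
    · rw [kernel.condition_assoc, zero_comp, ← Category.assoc, ← hej, Category.assoc, hc.1, comp_zero]
    · rw [reassoc_of% hVδ₀, reassoc_of% hVδ₁]
  have hdesc (s : Cofork (V.map k₀) (V.map k₁)) : ∃ z : Q ⟶ s.pt, c ≫ z = s.π := by
    refine hc.exists_desc s.π ?_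
    rw [← cancel_epi e, reassoc_of% hej, ← s.condition, kernel.condition_assoc, zero_comp, comp_zero]
  choose d hd using hdesc
  have := hc.epi
  refine ⟨K, j, e, ⟨R, Q, k₀, k₁, c, hk, ⟨wc, ⟨?_⟩⟩, hj'.isKernelOf hc⟩, hjμ, he, hej⟩
  exact Cofork.IsColimit.mk _ d hd fun s m hm => by
    rw [← cancel_epi c, hd]
    exact hm

lemma IsVOne.isProper {μ : V ⟶ 𝟭 C} (hμ : IsBirkhoffSubfunctor μ) {A₀ A K : C} {p : A₀ ⟶ A}
    {j : K ⟶ V.obj A₀} (hj : IsVOne V p j) : IsProper (j ≫ μ.app A₀) := by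
  obtain ⟨L, l, e, hl, hlμ, -⟩ := exists_isVOne hμ (IsKernelPair.of_hasPullback p)
  obtain ⟨i, hi⟩ := hl.exists_iso hj
  exact hlμ.of_iso i (by rw [reassoc_of% hi])

lemma IsVOne.exists_refinement {μ : V ⟶ 𝟭 C} (hμ : IsBirkhoffSubfunctor μ) {A₀ A K R T : C}
    {p : A₀ ⟶ A} {j : K ⟶ V.obj A₀} (hj : IsVOne V p j) {k₀ k₁ : R ⟶ A₀}
    (hk : IsKernelPair p k₀ k₁) (y : T ⟶ K) : ∃ (T' : C) (π : T' ⟶ T) (l : T' ⟶ V.obj R),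
      IsRegularEpi π ∧ l ≫ V.map k₀ = 0 ∧ l ≫ V.map k₁ = π ≫ y ≫ j := by
  obtain ⟨L, l, e, hl, -, he, hel⟩ := exists_isVOne hμ hk
  obtain ⟨i, hi⟩ := hj.exists_iso hl
  obtain ⟨T', π, x, hπ, hx⟩ := RelNilp.exists_refinement e (y ≫ i.hom)
  refine ⟨T', π, x ≫ kernel.ι _, hπ, by simp, ?_⟩
  rw [Category.assoc, ← hel, reassoc_of% hx, hi]

/-- `V₁` preserves regular epimorphisms of extensions. -/
lemma IsVOne.isRegularEpi_map {μ : V ⟶ 𝟭 C} (hμ : IsBirkhoffSubfunctor μ) {A₀ A B₀ B K L R S : C}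
    {p : A₀ ⟶ A} {q : B₀ ⟶ B} {j : K ⟶ V.obj A₀} {l : L ⟶ V.obj B₀} (hj : IsVOne V p j)
    (hl : IsVOne V q l) {p₀ p₁ : R ⟶ A₀} {q₀ q₁ : S ⟶ B₀} (hp : IsKernelPair p p₀ p₁)
    (hq : IsKernelPair q q₀ q₁) (f : A₀ ⟶ B₀) (F : R ⟶ S) (hF : IsRegularEpi F)
    (h₀ : F ≫ q₀ = p₀ ≫ f) (h₁ : F ≫ q₁ = p₁ ≫ f) (t : K ⟶ L) (ht : t ≫ l = j ≫ V.map f) :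
    IsRegularEpi t := by
  have := hl.mono
  have := hμ.map_regularEpi F hF
  let δ : A₀ ⟶ R := hp.lift (𝟙 A₀) (𝟙 A₀) rfl
  let ε : B₀ ⟶ S := hq.lift (𝟙 B₀) (𝟙 B₀) rfl
  have hδ : δ ≫ F = f ≫ ε := hq.hom_ext (by simp [h₀, δ, ε]) (by simp [h₁, δ, ε])
  refine isRegularEpi_of_refinement t fun {T} y => ?_
  obtain ⟨T₁, π₁, a, hπ₁, ha₀, ha₁⟩ := hl.exists_refinement hμ hq y
  obtain ⟨T₂, π₂, b, hπ₂, hb₀, hb⟩ := exists_refinement_kernel (V.map F) (f := V.map f)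
    (r := V.map p₀) (δ := V.map δ) (by rw [← V.map_comp, hp.lift_fst, V.map_id]) (s := V.map q₀)
    (ε := V.map ε) (by rw [← V.map_comp, h₀, V.map_comp]) (by rw [← V.map_comp, hδ, V.map_comp])
    a ha₀
  obtain ⟨x, hx⟩ := hj.exists_lift hp.w b hb₀
  refine ⟨T₂, π₂ ≫ π₁, x, isRegularEpi_comp _ _, ?_⟩
  rw [← cancel_mono l, Category.assoc, ht, reassoc_of% hx, ← V.map_comp, ← h₁, V.map_comp,
    reassoc_of% hb, ha₁, Category.assoc, Category.assoc]

end VOne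

/-! ### The lower central series and nilpotency -/

section LowerCentralSeries

variable {C : Type u} [Category.{v} C] [HasZeroMorphisms C] [ExactHomological C] {V : C ⥤ C}
  {μ : V ⟶ 𝟭 C}

lemma IsLowerCentralTerm.isProper (hμ : IsBirkhoffSubfunctor μ) {n : ℕ} {A K : C} {i : K ⟶ A}
    (hi : IsLowerCentralTerm μ n i) : IsProper i := by
  cases n with
  | zero =>
    have : IsIso i := hi
    exact ⟨A, 0, isKernelOf_of_exists_lift comp_zero fun x _ => ⟨x ≫ inv i, by simp⟩⟩
  | succ n =>
    obtain ⟨N, Q, m, η, j, hm, hη, hj, rfl⟩ := hi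
    exact hj.isProper hμ

lemma exists_isLowerCentralTerm (hμ : IsBirkhoffSubfunctor μ) (n : ℕ) (A : C) :
    ∃ (K : C) (i : K ⟶ A), IsLowerCentralTerm μ n i := by
  induction n with
  | zero => exact ⟨A, 𝟙 A, inferInstanceAs (IsIso (𝟙 A))⟩
  | succ n ih =>
    obtain ⟨N, m, hm⟩ := ih
    obtain ⟨Q, η, hη⟩ := (hm.isProper hμ).exists_isCokernelOf
    obtain ⟨K, j, e, hj, -⟩ := exists_isVOne hμ (IsKernelPair.of_hasPullback η)
    exact ⟨K, j ≫ μ.app A, N, Q, m, η, j, hm, hη, hj, rfl⟩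

omit [ExactHomological C] in
/-- The terms of the `V`-lower central series are functorial. -/
lemma IsLowerCentralTerm.exists_map {n : ℕ} {A B K L : C} {i : K ⟶ A}
    {l : L ⟶ B} (hi : IsLowerCentralTerm μ n i) (hl : IsLowerCentralTerm μ n l) (f : A ⟶ B) :
    ∃ t : K ⟶ L, t ≫ l = i ≫ f := by
  induction n generalizing K L with
  | zero =>
    have : IsIso l := hl
    exact ⟨i ≫ f ≫ inv l, by simp⟩
  | succ n ih =>
    obtain ⟨N, Q, m, η, j, hm, hη, hj, rfl⟩ := hi
    obtain ⟨N', Q', m', η', j', hm', hη', hj', rfl⟩ := hl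
    obtain ⟨s, hs⟩ := ih hm hm'
    obtain ⟨g, hg⟩ := hη.exists_desc (f ≫ η') (by rw [← reassoc_of% hs, hη'.1, comp_zero])
    obtain ⟨t, ht⟩ := hj.exists_map hj' f g hg
    have := μ.naturality f
    rw [Functor.id_map] at this
    exact ⟨t, by rw [reassoc_of% ht, this, Category.assoc]⟩

lemma IsLowerCentralTerm.exists_iso (hμ : IsBirkhoffSubfunctor μ) {n : ℕ} {A K L : C} {i : K ⟶ A}
    {l : L ⟶ A} (hi : IsLowerCentralTerm μ n i) (hl : IsLowerCentralTerm μ n l) :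
    ∃ e : K ≅ L, e.hom ≫ l = i := by
  have := (hi.isProper hμ).mono
  have := (hl.isProper hμ).mono
  obtain ⟨s, hs⟩ := hi.exists_map hl (𝟙 A)
  obtain ⟨t, ht⟩ := hl.exists_map hi (𝟙 A)
  rw [Category.comp_id] at hs ht
  exact ⟨⟨s, t, by rw [← cancel_mono i, Category.assoc, ht, hs, Category.id_comp],
    by rw [← cancel_mono l, Category.assoc, hs, ht, Category.id_comp]⟩, hs⟩

/-- The inductive core: the hypothesis at `n` makes the comparison of the kernel pairs of the
quotient maps regular epic, which is what `IsVOne.isRegularEpi_map` needs. -/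
lemma IsLowerCentralTerm.isRegularEpi_map (hμ : IsBirkhoffSubfunctor μ) {n : ℕ} {A B K L : C}
    {i : K ⟶ A} {l : L ⟶ B} (hi : IsLowerCentralTerm μ n i) (hl : IsLowerCentralTerm μ n l)
    (f : A ⟶ B) (hf : IsRegularEpi f) (t : K ⟶ L) (ht : t ≫ l = i ≫ f) : IsRegularEpi t := by
  induction n generalizing K L with
  | zero =>
    have : IsIso i := hi
    have : IsIso l := hl
    have := isRegularEpi_comp i f
    obtain rfl : t = (i ≫ f) ≫ inv l := by simp [← ht]
    exact isRegularEpi_comp _ _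
  | succ n ih =>
    have hlm := (hl.isProper hμ).mono
    obtain ⟨N, Q, m, η, j, hm, hη, hj, rfl⟩ := hi
    obtain ⟨N', Q', m', η', j', hm', hη', hj', rfl⟩ := hl
    obtain ⟨s, hs⟩ := hm.exists_map hm' f
    have hs' := ih hm hm' s hs
    obtain ⟨g, hg⟩ := hη.exists_desc (f ≫ η') (by rw [← reassoc_of% hs, hη'.1, comp_zero])
    have hp := IsKernelPair.of_hasPullback η
    have hq := IsKernelPair.of_hasPullback η'
    have w : (pullback.fst η η ≫ f) ≫ η' = (pullback.snd η η ≫ f) ≫ η' := by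
      rw [Category.assoc, Category.assoc, ← hg, pullback.condition_assoc]
    have hF := isRegularEpi_kernelPair_map ((hm.isProper hμ).isKernelOf hη)
      ((hm'.isProper hμ).isKernelOf hη') hp hq f s hs (hq.lift _ _ w) (hq.lift_fst _ _ w)
      (hq.lift_snd _ _ w)
    refine hj.isRegularEpi_map hμ hj' hp hq f _ hF (hq.lift_fst _ _ w) (hq.lift_snd _ _ w) t ?_
    have := (hμ.proper B).mono
    have h := μ.naturality f
    rw [Functor.id_map] at h
    rw [← cancel_mono (μ.app B), Category.assoc, ht, Category.assoc, Category.assoc, h]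

lemma exists_subfunctor_isLowerCentralTerm (hμ : IsBirkhoffSubfunctor μ) (n : ℕ) :
    ∃ (W : C ⥤ C) (ν : W ⟶ 𝟭 C), ∀ A : C, IsLowerCentralTerm μ n (ν.app A) := by
  choose K i hi using exists_isLowerCentralTerm hμ n
  have hm (A : C) : Mono (i A) := ((hi A).isProper hμ).mono
  choose t ht using fun (A B : C) (f : A ⟶ B) => (hi A).exists_map (hi B) f
  let W : C ⥤ C :=
    { obj := K
      map := fun {A B} f => t A B f
      map_id := fun A => by rw [← cancel_mono (i A), ht, Category.comp_id, Category.id_comp]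
      map_comp := fun {A B D} f g => by
        rw [← cancel_mono (i D), ht, Category.assoc, ht, reassoc_of% ht A B f] }
  exact ⟨W, { app := i, naturality := fun A B f => ht A B f }, hi⟩

omit [HasZeroMorphisms C] in
lemma isRegularEpi_kernelPair_map_of_comp {A B Q R S : C} (f : A ⟶ B) [IsRegularEpi f] {q : B ⟶ Q}
    {p₀ p₁ : R ⟶ A} {q₀ q₁ : S ⟶ B} (hp : IsKernelPair (f ≫ q) p₀ p₁) (hq : IsKernelPair q q₀ q₁)
    (F : R ⟶ S) (h₀ : F ≫ q₀ = p₀ ≫ f) (h₁ : F ≫ q₁ = p₁ ≫ f) : IsRegularEpi F := by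
  refine isRegularEpi_of_refinement F fun {T} y => ?_
  obtain ⟨T₁, π₁, a, hπ₁, ha⟩ := exists_refinement f (y ≫ q₀)
  obtain ⟨T₂, π₂, b, hπ₂, hb⟩ := exists_refinement f (π₁ ≫ y ≫ q₁)
  have w : (π₂ ≫ a) ≫ f ≫ q = b ≫ f ≫ q := by
    rw [Category.assoc, reassoc_of% ha, reassoc_of% hb, hq.w]
  refine ⟨T₂, π₂ ≫ π₁, hp.lift _ _ w, isRegularEpi_comp _ _, hq.hom_ext ?_ ?_⟩
  · rw [Category.assoc, h₀, hp.lift_fst_assoc, Category.assoc, ha]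
    simp
  · rw [Category.assoc, h₁, hp.lift_snd_assoc, hb]
    simp

/-- The `V`-lower central series of `A` is a `V`-central series. -/
lemma isCentralSeries_of_isLowerCentralTerm (hμ : IsBirkhoffSubfunctor μ) {A : C} (K : ℕ → C)
    (i : ∀ n, K n ⟶ A) [∀ n, Mono (i n)] (hi : ∀ n, IsLowerCentralTerm μ n (i n)) :
    IsCentralSeries V A fun n => Subobject.mk (i n) where
  zero := by
    have : IsIso (i 0) := hi 0
    exact Subobject.mk_eq_top_of_isIso (i 0)
  antitone := antitone_nat_of_succ_le fun n => by
    obtain ⟨N, Q, m, η, j, hm, hη, hj, hji⟩ := hi (n + 1)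
    obtain ⟨e, he⟩ := hm.exists_iso hμ (hi n)
    obtain ⟨z, hz⟩ := ((hm.isProper hμ).isKernelOf hη).exists_lift (i (n + 1))
      (by rw [← hji, hj.comp_eq_zero])
    exact Subobject.mk_le_mk_of_comm (z ≫ e.hom) (by rw [Category.assoc, he, hz])
  proper n := ((hi n).isProper hμ).of_iso (Subobject.underlyingIso (i n)).symm (by simp)
  central n := by
    have hi' := hi (n + 1)
    obtain ⟨N, Q, m, η, j, hm, hη, hj, hji⟩ := hi'
    obtain ⟨e, he⟩ := hm.exists_iso hμ (hi n)
    obtain ⟨Q', q', hq'⟩ := ((hi (n + 1)).isProper hμ).exists_isCokernelOf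
    obtain ⟨f, rfl⟩ := hq'.exists_desc η (by rw [← hji, hj.comp_eq_zero])
    refine ⟨Q', Q, q', q' ≫ f, f, hq'.of_iso (Subobject.underlyingIso _).symm (by simp),
      hη.of_iso (e ≪≫ (Subobject.underlyingIso _).symm) (by simpa using he), rfl, ?_⟩
    have := hη.isRegularEpi
    have := hq'.isRegularEpi
    have hp := IsKernelPair.of_hasPullback (q' ≫ f)
    have hq := IsKernelPair.of_hasPullback f
    obtain ⟨L, l, -, hl, -⟩ := exists_isVOne hμ hq
    refine ⟨isRegularEpi_of_comp q' f, L, l, hl, ?_⟩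
    obtain ⟨t, ht⟩ := hj.exists_map hl q' (𝟙 Q) (Category.comp_id _)
    have w : (pullback.fst (q' ≫ f) (q' ≫ f) ≫ q') ≫ f =
        (pullback.snd (q' ≫ f) (q' ≫ f) ≫ q') ≫ f := by
      rw [Category.assoc, Category.assoc, pullback.condition]
    have hF := isRegularEpi_kernelPair_map_of_comp q' hp hq (hq.lift _ _ w) (hq.lift_fst _ _ w)
      (hq.lift_snd _ _ w)
    -- `V₁ f` is a regular image of `V₁ⁿ⁺¹(A)`, and the map is zero because `q'` kills `V₁ⁿ⁺¹(A)`.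
    have := hj.isRegularEpi_map hμ hl hp hq q' _ hF (hq.lift_fst _ _ w) (hq.lift_snd _ _ w) t ht
    have := hl.mono
    have := (hμ.proper Q').mono
    refine isZero_of_epi_eq_zero t ?_
    have h := μ.naturality q'
    rw [Functor.id_map] at h
    rw [← cancel_mono l, ht, ← cancel_mono (μ.app Q'), Category.assoc, h, reassoc_of% hji, hq'.1,
      zero_comp, zero_comp]

omit [ExactHomological C] in
/-- Every `V`-central series contains the `V`-lower central series. -/
lemma IsCentralSeries.exists_factor {A : C} {S : ℕ → Subobject A}
    (hS : IsCentralSeries V A S) {n : ℕ} {K : C} {i : K ⟶ A} (hi : IsLowerCentralTerm μ n i) :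
    ∃ t : K ⟶ (S n : C), t ≫ (S n).arrow = i := by
  induction n generalizing K with
  | zero =>
    have : IsIso (S 0).arrow := (Subobject.isIso_arrow_iff_eq_top _).2 hS.zero
    exact ⟨i ≫ inv (S 0).arrow, by simp⟩
  | succ n ih =>
    obtain ⟨N, Q, m, η, j, hm, hη, hj, rfl⟩ := hi
    obtain ⟨s, hs⟩ := ih hm
    obtain ⟨Q', Q₀, q', q, f, hq', hq, rfl, -, L, l, hl, hL⟩ := hS.central n
    obtain ⟨g, hg⟩ := hη.exists_desc (q' ≫ f) (by rw [← hs, Category.assoc, hq.1, comp_zero])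
    -- Modulo `S (n + 1)`, the term `V₁ⁿ⁺¹(A)` passes through `V₁ f = 0`; hence it lies in `S (n +
    -- 1)`, the kernel of `q'`.
    obtain ⟨t, ht⟩ := hj.exists_map hl q' g hg
    refine ((hS.proper (n + 1)).isKernelOf hq').exists_lift _ ?_
    have h := μ.naturality q'
    rw [Functor.id_map] at h
    rw [Category.assoc, ← h, ← reassoc_of% ht, hL.eq_of_tgt t 0, zero_comp]

lemma IsLowerCentralTerm.isNilpotentOfClass_iff (hμ : IsBirkhoffSubfunctor μ) {n : ℕ} {A K : C}
    {i : K ⟶ A} (hi : IsLowerCentralTerm μ n i) : IsNilpotentOfClass V n A ↔ IsZero K := by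
  constructor
  · rintro ⟨S, hS, hn⟩
    have := (hi.isProper hμ).mono
    obtain ⟨t, ht⟩ := hS.exists_factor hi
    exact isZero_of_mono_eq_zero i (by rw [← ht, hn.eq_of_tgt t 0, zero_comp])
  · intro hK
    choose L l hl using fun n => exists_isLowerCentralTerm hμ n A
    have hm (n : ℕ) : Mono (l n) := ((hl n).isProper hμ).mono
    obtain ⟨e, -⟩ := (hl n).exists_iso hμ hi
    exact ⟨_, isCentralSeries_of_isLowerCentralTerm hμ L l hl,
      hK.of_iso (Subobject.underlyingIso (l n) ≪≫ e)⟩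

end LowerCentralSeries

/-! ### From Birkhoff subfunctors to Birkhoff subcategories -/

section Birkhoff

variable {C : Type u} [Category.{v} C] [HasZeroMorphisms C]

omit [HasZeroMorphisms C] in
lemma nonempty_reflective_of_exists_isReflection (P : ObjectProperty C)
    (h : ∀ A : C, ∃ (B : C) (η : A ⟶ B), IsReflection P η) : Nonempty (Reflective P.ι) := by
  choose B η hη using h
  let e (A : C) (X : P.FullSubcategory) : ((⟨B A, (hη A).1⟩ : P.FullSubcategory) ⟶ X) ≃
      (A ⟶ P.ι.obj X) :=
    Equiv.ofBijective (fun h => η A ≫ h.hom) ⟨fun a b hab =>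
      ObjectProperty.hom_ext _ (((hη A).2 X.obj X.property _).unique hab rfl), fun g =>
      let ⟨h, hh, _⟩ := (hη A).2 X.obj X.property g
      ⟨ObjectProperty.homMk h, hh⟩⟩
  exact ⟨{ L := Adjunction.leftAdjointOfEquiv e fun _ _ _ _ _ => (Category.assoc _ _ _).symm
           adj := Adjunction.adjunctionOfEquivLeft e _ }⟩

/-- The objects on which a Birkhoff subfunctor vanishes form its corresponding subcategory. -/
lemma IsBirkhoffSubfunctor.isCorrespondingSubcategory [ExactHomological C] {W : C ⥤ C}
    {ν : W ⟶ 𝟭 C} (hν : IsBirkhoffSubfunctor ν) {P : ObjectProperty C}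
    (hP : ∀ A : C, P A ↔ IsZero (W.obj A)) : IsCorrespondingSubcategory ν P := by
  have hm (A : C) : Mono (ν.app A) := (hν.proper A).mono
  have hnat {A B : C} (f : A ⟶ B) : W.map f ≫ ν.app B = ν.app A ≫ f := ν.naturality f
  have hquot {A B : C} {η : A ⟶ B} (hη : IsCokernelOf η (ν.app A)) : P B := by
    -- `W(A) ⟶ W(B)` is epic, but becomes zero in `B` by naturality, so `W(B) = 0`.
    have := hν.map_regularEpi η hη.isRegularEpi
    refine (hP B).2 (isZero_of_epi_eq_zero (W.map η) ?_)
    rw [← cancel_mono (ν.app B), hnat, hη.1, zero_comp]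
  have hrefl {A B : C} {η : A ⟶ B} (hη : IsCokernelOf η (ν.app A)) : IsReflection P η := by
    refine ⟨hquot hη, fun X hX g => ?_⟩
    obtain ⟨h, hh⟩ := hη.exists_desc g
      (by rw [← hnat, ((hP X).1 hX).eq_of_src (ν.app X) 0, comp_zero])
    have := hη.epi
    exact ⟨h, hh, fun h' hh' => by rw [← cancel_epi η, hh, hh']⟩
  have hex (A : C) : ∃ (B : C) (η : A ⟶ B),
      IsKernelOf (ν.app A) η ∧ IsCokernelOf η (ν.app A) ∧ IsReflection P η := by
    obtain ⟨B, η, hη⟩ := (hν.proper A).exists_isCokernelOf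
    exact ⟨B, η, (hν.proper A).isKernelOf hη, hη, hrefl hη⟩
  refine ⟨⟨nonempty_reflective_of_exists_isReflection P fun A => ?_, ?_, ?_⟩, fun B => ⟨?_, ?_⟩, hex⟩
  · obtain ⟨B, η, -, -, h⟩ := hex A
    exact ⟨B, η, h⟩
  · intro X Y m _ hY
    refine (hP X).2 (isZero_of_mono_eq_zero (ν.app X) ?_)
    rw [← cancel_mono m, ← hnat, ((hP Y).1 hY).eq_of_src (ν.app Y) 0, comp_zero, zero_comp]
  · intro X Y e he hX
    have := hν.map_regularEpi e he
    exact (hP Y).2 (isZero_of_epi_eq_zero (W.map e) (((hP X).1 hX).eq_of_src _ _))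
  · intro hB
    refine ⟨B, 𝟙 B, isCokernelOf_of_exists_desc (((hP B).1 hB).eq_of_src _ _)
      fun x _ => ⟨x, Category.id_comp x⟩⟩
  · rintro ⟨A, η, hη⟩
    exact hquot hη

end Birkhoff

end RelNilp

theorem mainTheorem10 {C : Type u} [Category.{v} C] [HasZeroMorphisms C]
    [RelNilp.ExactHomological C] {V : C ⥤ C} (μ : V ⟶ 𝟭 C)
    (hμ : RelNilp.IsBirkhoffSubfunctor μ) (n : ℕ) :
    -- the terms `V₁ⁿ(A)` exist, are unique up to isomorphism and form a subfunctor of the identity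
    (∃ (W : C ⥤ C) (ν : W ⟶ 𝟭 C), ∀ A : C, RelNilp.IsLowerCentralTerm μ n (ν.app A)) ∧
    (∀ {A K K' : C} (i : K ⟶ A) (i' : K' ⟶ A), RelNilp.IsLowerCentralTerm μ n i →
      RelNilp.IsLowerCentralTerm μ n i' → ∃ e : K ≅ K', e.hom ≫ i' = i) ∧
    -- `A` is `V`-nilpotent of class `n` if and only if `V₁ⁿ(A) = 0`
    (∀ {A K : C} (i : K ⟶ A), RelNilp.IsLowerCentralTerm μ n i →
      (RelNilp.IsNilpotentOfClass V n A ↔ IsZero K)) ∧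
    -- `V₁ⁿ` is a Birkhoff subfunctor; the corresponding Birkhoff subcategory is that of the objects
    -- of `V`-nilpotency class `n`
    (∀ (W : C ⥤ C) (ν : W ⟶ 𝟭 C), (∀ A : C, RelNilp.IsLowerCentralTerm μ n (ν.app A)) →
      RelNilp.IsBirkhoffSubfunctor ν ∧
      RelNilp.IsCorrespondingSubcategory ν (RelNilp.IsNilpotentOfClass V n)) := by
  refine ⟨RelNilp.exists_subfunctor_isLowerCentralTerm hμ n, fun i i' hi hi' => hi.exists_iso hμ hi',
    fun i hi => hi.isNilpotentOfClass_iff hμ, fun W ν hν => ?_⟩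
  have hW : RelNilp.IsBirkhoffSubfunctor ν :=
    ⟨fun A => (hν A).isProper hμ, fun {A B} p hp =>
      (hν A).isRegularEpi_map hμ (hν B) p hp (W.map p) (ν.naturality p)⟩
  exact ⟨hW, hW.isCorrespondingSubcategory fun A => (hν A).isNilpotentOfClass_iff hμ⟩
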